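/- Let $k$ and $l$ be distinct positive integers, and let $G$ be a finite abelian group, written additively, of order $n$ and exponent $v$ (the largest order of an element of $G$). For a subset $A$ of a finite abelian group and a positive integer $h$, let $hA$ denote the set of all sums of $h$ (not necessarily distinct) elements of $A$; call $A$ $(k,l)$-sum-free if $kA \cap lA = \emptyset$, and let $\lambda_{k,l}(G)$ be the maximum size of a $(k,l)$-sum-free subset of $G$. For a positive integer $d$ set $\delta(d) = \gcd(d, k-l)$. If $v$ has at least one positive divisor $d$ that is not congruent modulo $k+l$ to any integer $j$ with $1 \le j \le \delta(d)$, then $$\lambda_{k,l}(G) = \lambda_{k,l}(\mathbb{Z}_v)\cdot \frac{n}{v}.$$ -/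

import Mathlib

/-- The `h`-fold sumset `hA`: all sums of `h` (not necessarily distinct) elements of `A`. -/
def hFoldSumset {G : Type*} [AddCommGroup G] (h : ℕ) (A : Set G) : Set G :=
  {x | ∃ f : Fin h → G, (∀ i, f i ∈ A) ∧ ∑ i, f i = x}

/-- `A` is `(k,l)`-sum-free: `kA ∩ lA = ∅`. -/
def IsSumFreeKL {G : Type*} [AddCommGroup G] (k l : ℕ) (A : Set G) : Prop :=
  hFoldSumset k A ∩ hFoldSumset l A = ∅

/-- `λ_{k,l}(G)`: the maximum size of a `(k,l)`-sum-free subset of `G`. For a finite group `G`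
and `k, l ≥ 1`, the set of sizes is bounded by the order of `G` and contains `0`, so this supremum
is a maximum. -/
noncomputable def maxSumFreeKL (k l : ℕ) (G : Type*) [AddCommGroup G] : ℕ :=
  sSup {m : ℕ | ∃ A : Finset G, IsSumFreeKL k l (A : Set G) ∧ A.card = m}

/-- `δ(d) = gcd(d, k - l)`, with `k - l` taken as an integer. -/
def deltaKL (k l d : ℕ) : ℕ :=
  Int.gcd (d : ℤ) ((k : ℤ) - (l : ℤ))

/-!
Pulling back along a surjection shows that the density of a largest `(k, l)`-sum-free set does not
decrease from a quotient to the group, and `ZMod v` is a quotient of `G`; so it suffices to bound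
the density of a sum-free `B ⊆ G` by that of `ZMod v`.

If `|B| ≤ |G| / (k + l)`, an interval of residues modulo `d` does at least as well: the starting
point `c` is chosen so that its `k`-fold sumset starts just after its `l`-fold sumset ends. Only
multiples of `δ(d)` are available as the distance `(k - l)c` of the starting points, and the
hypothesis on `d` says precisely that an interval of length `⌈d / (k + l)⌉` leaves room for this.

If `|B| > |G| / (k + l)`, some surjection onto a cyclic group keeps the image of `B` sum-free.
Dividing by the stabilizer of `T = kB - lB` one may assume that `T` is aperiodic. Aperiodicity
forces `|N + B| ≥ |N| + |B|` for every nonzero subgroup `N` having no coset that contains `B`.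
Hamidoune's isoperimetric method then gives `|X + B| ≥ |X| + |B| - 1` as in Mann's theorem, and
without the `-1` as in Vosper's theorem when `G` is not cyclic and `X + B` misses two elements.
Iterating over the `k + l` summands of `T` gives `|G| ≥ (k + l)|B|`, unless `G` is cyclic or
`|B| = 1`; in the last case `T` is a single nonzero element and some character does not vanish
on it.
-/

open AddAction (stabilizer)
open scoped Pointwise

section Sumsets

variable {G Q : Type*} [AddCommGroup G] [AddCommGroup Q]

theorem hFoldSumset_zero (A : Set G) : hFoldSumset 0 A = 0 := by
  ext x
  simp [hFoldSumset, eq_comm]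

theorem hFoldSumset_succ (h : ℕ) (A : Set G) : hFoldSumset (h + 1) A = hFoldSumset h A + A := by
  ext x
  simp only [Set.mem_add]
  constructor
  · rintro ⟨f, hf, rfl⟩
    exact ⟨_, ⟨f ∘ Fin.castSucc, fun i => hf _, rfl⟩, _, hf (Fin.last h),
      (Fin.sum_univ_castSucc f).symm⟩
  · rintro ⟨_, ⟨f, hf, rfl⟩, a, ha, rfl⟩
    exact ⟨Fin.snoc f a, Fin.lastCases (by simpa using ha) (by simpa using hf),
      by simp [Fin.sum_univ_castSucc]⟩

theorem hFoldSumset_image (φ : G →+ Q) (h : ℕ) (A : Set G) :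
    hFoldSumset h (φ '' A) = φ '' hFoldSumset h A := by
  induction h with
  | zero => simp only [hFoldSumset_zero, Set.image_zero, map_zero, Set.singleton_zero]
  | succ h ih => simp only [hFoldSumset_succ, ih, Set.image_add]

theorem hFoldSumset_neg (h : ℕ) (A : Set G) : hFoldSumset h (-A) = -hFoldSumset h A := by
  induction h with
  | zero => simp only [hFoldSumset_zero, neg_zero]
  | succ h ih => simp only [hFoldSumset_succ, ih, neg_add]

theorem hFoldSumset_nonempty {A : Set G} (hA : A.Nonempty) (h : ℕ) :
    (hFoldSumset h A).Nonempty :=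
  let ⟨a, ha⟩ := hA
  ⟨_, fun _ => a, fun _ => ha, rfl⟩

/-- The set `kA - lA`, whose avoidance of `0` expresses that `A` is `(k, l)`-sum-free. -/
def hFoldDifference (k l : ℕ) (A : Set G) : Set G :=
  hFoldSumset k A - hFoldSumset l A

theorem hFoldDifference_eq_add (k l : ℕ) (A : Set G) :
    hFoldDifference k l A = hFoldSumset k A + hFoldSumset l (-A) := by
  rw [hFoldDifference, sub_eq_add_neg, hFoldSumset_neg]

theorem hFoldDifference_succ_right (k l : ℕ) (A : Set G) :
    hFoldDifference k (l + 1) A = hFoldDifference k l A - A := by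
  simp only [hFoldDifference, hFoldSumset_succ, sub_eq_add_neg, neg_add, add_assoc]

theorem hFoldDifference_image (φ : G →+ Q) (k l : ℕ) (A : Set G) :
    hFoldDifference k l (φ '' A) = φ '' hFoldDifference k l A := by
  simp only [hFoldDifference, hFoldSumset_image, Set.image_sub]

theorem isSumFreeKL_iff_zero_notMem_hFoldDifference {k l : ℕ} {A : Set G} :
    IsSumFreeKL k l A ↔ 0 ∉ hFoldDifference k l A := by
  rw [IsSumFreeKL, ← Set.disjoint_iff_inter_eq_empty, hFoldDifference, Set.zero_mem_sub_iff,
    not_not]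

theorem isSumFreeKL_image_iff {k l : ℕ} {A : Set G} (φ : G →+ Q) :
    IsSumFreeKL k l (φ '' A) ↔ ∀ x ∈ hFoldDifference k l A, φ x ≠ 0 := by
  simp only [isSumFreeKL_iff_zero_notMem_hFoldDifference, hFoldDifference_image, Set.mem_image,
    not_exists, not_and, ne_eq]

theorem isSumFreeKL_comm {k l : ℕ} {A : Set G} : IsSumFreeKL k l A ↔ IsSumFreeKL l k A := by
  rw [IsSumFreeKL, Set.inter_comm, IsSumFreeKL]

theorem IsSumFreeKL.preimage {k l : ℕ} {C : Set Q} (hC : IsSumFreeKL k l C) (φ : G →+ Q) :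
    IsSumFreeKL k l (φ ⁻¹' C) := by
  have himage : IsSumFreeKL k l (φ '' (φ ⁻¹' C)) := by
    refine Set.eq_empty_of_subset_empty fun x hx => ?_
    rw [← hC]
    obtain ⟨⟨f, hf, rfl⟩, g, hg, hfg⟩ := hx
    exact ⟨⟨f, fun i => Set.image_preimage_subset _ _ (hf i), rfl⟩,
      g, fun i => Set.image_preimage_subset _ _ (hg i), hfg⟩
  rw [isSumFreeKL_iff_zero_notMem_hFoldDifference]
  exact fun h => (isSumFreeKL_image_iff φ).1 himage 0 h (map_zero φ)

end Sumsets

section CosetSpan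

variable {G : Type*} [AddCommGroup G]

/-- The smallest subgroup having a coset that contains `A`; unlike the subgroup generated by `A`,
it is invariant under translations of `A`. -/
def cosetSpan (A : Set G) : AddSubgroup G :=
  AddSubgroup.closure (A - A)

theorem cosetSpan_le {A : Set G} {N : AddSubgroup G} :
    cosetSpan A ≤ N ↔ ∀ a ∈ A, ∀ b ∈ A, a - b ∈ N := by
  rw [cosetSpan, AddSubgroup.closure_le, Set.sub_subset_iff]
  rfl

theorem sub_mem_cosetSpan {A : Set G} {a b : G} (ha : a ∈ A) (hb : b ∈ A) : a - b ∈ cosetSpan A :=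
  cosetSpan_le.1 le_rfl a ha b hb

theorem cosetSpan_neg (A : Set G) : cosetSpan (-A) = cosetSpan A := by
  rw [cosetSpan, neg_sub_neg, cosetSpan]

theorem cosetSpan_add_le {A B : Set G} {N : AddSubgroup G} (hA : cosetSpan A ≤ N)
    (hB : cosetSpan B ≤ N) : cosetSpan (A + B) ≤ N := by
  rw [cosetSpan_le] at *
  rintro _ ⟨a, ha, b, hb, rfl⟩ _ ⟨a', ha', b', hb', rfl⟩
  simpa only [add_sub_add_comm] using add_mem (hA a ha a' ha') (hB b hb b' hb')

theorem cosetSpan_hFoldSumset_le (h : ℕ) (A : Set G) :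
    cosetSpan (hFoldSumset h A) ≤ cosetSpan A := by
  induction h with
  | zero => simp [hFoldSumset_zero, cosetSpan_le]
  | succ h ih => rw [hFoldSumset_succ]; exact cosetSpan_add_le ih le_rfl

theorem cosetSpan_hFoldDifference_le (k l : ℕ) (A : Set G) :
    cosetSpan (hFoldDifference k l A) ≤ cosetSpan A := by
  rw [hFoldDifference_eq_add]
  exact cosetSpan_add_le (cosetSpan_hFoldSumset_le k A)
    (cosetSpan_neg A ▸ cosetSpan_hFoldSumset_le l (-A))

theorem isAddCyclic_of_cosetSpan_eq_top {A : Set G} (hA : cosetSpan A = ⊤) (hcard : A.ncard = 2) :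
    IsAddCyclic G := by
  obtain ⟨a, b, -, rfl⟩ := Set.ncard_eq_two.1 hcard
  have hzmultiples : cosetSpan {a, b} ≤ AddSubgroup.zmultiples (a - b) := by
    have hab := AddSubgroup.mem_zmultiples (a - b)
    have hba : b - a ∈ AddSubgroup.zmultiples (a - b) := neg_sub a b ▸ neg_mem hab
    simp [cosetSpan_le, hba]
  exact ⟨a - b, fun x => hzmultiples (hA ▸ AddSubgroup.mem_top x)⟩

end CosetSpan

section IsoperimetricMethod

variable {G : Type*} [AddCommGroup G] {k : ℕ} {A M N X : Set G}

/-- `X` is `k`-separable with respect to `A`: both `X` and the complement of `X + A` have at least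
`k` elements. These are the sets over which the isoperimetric method minimises `|X + A| - |X|`. -/
def IsSumsetSeparable (k : ℕ) (A X : Set G) : Prop :=
  k ≤ X.ncard ∧ (X + A).ncard + k ≤ Nat.card G

theorem IsSumsetSeparable.vadd (h : IsSumsetSeparable k A X) (g : G) :
    IsSumsetSeparable k A (g +ᵥ X) := by
  simpa only [IsSumsetSeparable, vadd_add_assoc, Set.ncard_vadd_set] using h

/-- A `k`-atom of `A` in the sense of Hamidoune: a set of minimal cardinality among the
`k`-separable sets `X` that minimise `|X + A| - |X|`. The inequalities between differences are
rearranged so that no subtraction occurs. -/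
structure IsSumsetAtom (k : ℕ) (A M : Set G) : Prop where
  separable : IsSumsetSeparable k A M
  ncard_add_le : ∀ X, IsSumsetSeparable k A X → (M + A).ncard + X.ncard ≤ (X + A).ncard + M.ncard
  ncard_le : ∀ X, IsSumsetSeparable k A X →
    (X + A).ncard + M.ncard ≤ (M + A).ncard + X.ncard → M.ncard ≤ X.ncard

theorem IsSumsetAtom.vadd (h : IsSumsetAtom k A M) (g : G) : IsSumsetAtom k A (g +ᵥ M) := by
  refine ⟨h.separable.vadd g, ?_, ?_⟩ <;> simp only [vadd_add_assoc, Set.ncard_vadd_set]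
  exacts [h.ncard_add_le, h.ncard_le]

variable [Finite G]

theorem IsSumsetSeparable.exists_isSumsetAtom (hX : IsSumsetSeparable k A X) :
    ∃ M, IsSumsetAtom k A M := by
  obtain ⟨M, hM, hmin⟩ := Set.exists_min_image {X | IsSumsetSeparable k A X}
    (fun X => toLex (((X + A).ncard : ℤ) - X.ncard, X.ncard)) (Set.toFinite _) ⟨X, hX⟩
  simp only [Prod.Lex.toLex_le_toLex] at hmin
  refine ⟨M, hM, fun Y hY => ?_, fun Y hY hle => ?_⟩ <;> have := hmin Y hY <;> lia

theorem IsSumsetSeparable.exists_isSumsetAtom_zero_mem (hX : IsSumsetSeparable k A X)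
    (hk : 0 < k) : ∃ M, IsSumsetAtom k A M ∧ 0 ∈ M := by
  obtain ⟨M, hM⟩ := hX.exists_isSumsetAtom
  obtain ⟨x, hx⟩ := Set.nonempty_of_ncard_ne_zero (hk.trans_le hM.separable.1).ne'
  exact ⟨-x +ᵥ M, hM.vadd _, x, hx, neg_add_cancel x⟩

theorem IsSumsetAtom.ncard_add_ncard_add_le (hM : IsSumsetAtom k A M) :
    M.ncard + (M + A).ncard ≤ Nat.card G := by
  -- Duality: `D` is separable and `|D + A| - |D| ≤ |M + A| - |M|`, hence `|M| ≤ |D|`.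
  set D : Set G := -(M + A)ᶜ
  have hD : D.ncard + (M + A).ncard = Nat.card G := by
    rw [Set.ncard_neg, add_comm, Set.ncard_add_ncard_compl]
  have hDA : (D + A).ncard + M.ncard ≤ Nat.card G := by
    rw [← Set.ncard_add_ncard_compl (-M), Set.ncard_neg, add_comm]
    gcongr
    · exact Set.toFinite _
    · rintro _ ⟨d, hd, a, ha, rfl⟩ hmem
      exact hd ⟨-(d + a), hmem, a, ha, by simp⟩
  obtain ⟨hcard, hsum⟩ := hM.separable
  have := hM.ncard_le D ⟨by lia, by lia⟩ (by lia)
  lia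

theorem ncard_union_add_add_ncard_inter_add_le (M N A : Set G) :
    (M ∪ N + A).ncard + (M ∩ N + A).ncard ≤ (M + A).ncard + (N + A).ncard := by
  rw [← Set.ncard_union_add_ncard_inter (M + A), Set.union_add]
  gcongr
  · exact Set.toFinite _
  · exact Set.inter_add_subset

theorem IsSumsetAtom.eq_of_le_ncard_inter (hM : IsSumsetAtom k A M) (hN : IsSumsetAtom k A N)
    (hMN : k ≤ (M ∩ N).ncard) : M = N := by
  have hsubmodular := ncard_union_add_add_ncard_inter_add_le M N A
  have hcard := Set.ncard_union_add_ncard_inter M N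
  have := hM.ncard_add_ncard_add_le
  have := hM.ncard_add_le N hN.separable
  have := hN.ncard_add_le M hM.separable
  have := hM.ncard_le N hN.separable (by lia)
  have := hN.ncard_le M hM.separable (by lia)
  have hinter : M.ncard ≤ (M ∩ N).ncard := by
    have hle : (M ∩ N + A).ncard ≤ (M + A).ncard :=
      Set.ncard_le_ncard (Set.add_subset_add_right Set.inter_subset_left)
    have : (M + A).ncard + k ≤ Nat.card G := hM.separable.2
    by_contra! hlt
    have hfar := mt (hM.ncard_le (M ∩ N) ⟨hMN, by lia⟩) hlt.not_ge
    have := hN.ncard_add_le (M ∪ N) ⟨by lia, by lia⟩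
    lia
  exact (Set.eq_of_subset_of_ncard_le Set.inter_subset_left hinter).symm.trans
    (Set.eq_of_subset_of_ncard_le Set.inter_subset_right (by lia))

theorem IsSumsetAtom.coe_stabilizer_eq (hM : IsSumsetAtom k A M) (hzero : 0 ∈ M)
    (hinter : ∀ x ∈ M, k ≤ (M ∩ (x +ᵥ M)).ncard) : (stabilizer G M : Set G) = M := by
  ext x
  refine ⟨fun hx => ?_, fun hx => (hM.eq_of_le_ncard_inter (hM.vadd x) (hinter x hx)).symm⟩
  rw [← AddAction.mem_stabilizer_iff.1 hx]
  exact ⟨0, hzero, add_zero x⟩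

theorem exists_addSubgroup_ncard_add_lt (hX : X.Nonempty) (hXA : X + A ≠ Set.univ)
    (hlt : (X + A).ncard + 1 < X.ncard + A.ncard) :
    ∃ H : AddSubgroup G, H ≠ ⊥ ∧ (H + A : Set G) ≠ Set.univ ∧
      (H + A : Set G).ncard + 1 < (H : Set G).ncard + A.ncard := by
  have hseparable : IsSumsetSeparable 1 A X :=
    ⟨hX.ncard_pos, Set.ncard_lt_card hXA⟩
  obtain ⟨M, hM, hzero⟩ := hseparable.exists_isSumsetAtom_zero_mem one_pos
  have hstab : (stabilizer G M : Set G) = M := hM.coe_stabilizer_eq hzero fun x hx =>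
    (Set.ncard_pos (Set.toFinite _)).2 ⟨x, hx, 0, hzero, add_zero x⟩
  have hMA := hM.ncard_add_le X hseparable
  refine ⟨stabilizer G M, fun hbot => ?_, ?_, ?_⟩
  · rw [hbot, AddSubgroup.coe_bot] at hstab
    simp only [← hstab, Set.ncard_singleton, Set.singleton_add, zero_add, Set.image_id'] at hMA
    lia
  · rw [hstab]
    intro huniv
    have := hM.separable.2
    rw [huniv, Set.ncard_univ] at this
    lia
  · rw [hstab]
    lia

end IsoperimetricMethod

section CosetDecomposition

variable {G : Type*} [AddCommGroup G] {A X : Set G} {K : AddSubgroup G}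

theorem subset_vadd_cosetSpan {a : G} (ha : a ∈ A) : A ⊆ a +ᵥ (cosetSpan A : Set G) := fun b hb =>
  ⟨b - a, sub_mem_cosetSpan hb ha, add_sub_cancel a b⟩

theorem exists_vadd_image_subtype_eq {x : G} (hX : X ⊆ x +ᵥ (K : Set G)) :
    ∃ Y : Set K, x +ᵥ (K.subtype '' Y) = X := by
  obtain ⟨Y, hY⟩ : ∃ Y : Set K, K.subtype '' Y = -x +ᵥ X := by
    rw [← Set.subset_range_iff_exists_image_eq, AddSubgroup.coe_subtype, Subtype.range_coe]
    rwa [Set.vadd_set_subset_iff_subset_neg_vadd_set, neg_neg]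
  exact ⟨Y, by rw [hY, vadd_neg_vadd]⟩

theorem vadd_image_subtype_add (x a : G) (Y B : Set K) :
    (x +ᵥ (K.subtype '' Y)) + (a +ᵥ (K.subtype '' B)) =
      (x + a) +ᵥ (K.subtype '' (Y + B)) := by
  rw [vadd_add_assoc, add_vadd_comm, vadd_vadd, Set.image_add]

theorem ncard_vadd_image_subtype (x : G) (Y : Set K) :
    (x +ᵥ (K.subtype '' Y)).ncard = Y.ncard := by
  rw [Set.ncard_vadd_set, Set.ncard_image_of_injective _ K.subtype_injective]

theorem le_stabilizer_add_of_le_stabilizer (hX : K ≤ stabilizer G X) :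
    K ≤ stabilizer G (X + A) := fun g hg => by
  rw [AddAction.mem_stabilizer_iff, ← vadd_add_assoc, hX hg]

theorem ncard_add_cosetSpan_eq (hA : A.Nonempty) (hstab : cosetSpan A ≤ stabilizer G (X + A)) :
    (X + (cosetSpan A : Set G)).ncard = (X + A).ncard := by
  obtain ⟨a, ha⟩ := hA
  rw [← Set.ncard_vadd_set a]
  congr 1
  apply Set.Subset.antisymm
  · rintro _ ⟨_, ⟨x, hx, g, hg, rfl⟩, rfl⟩
    rw [← hstab hg]
    exact ⟨x + a, Set.add_mem_add hx ha, by simp only [vadd_eq_add]; abel⟩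
  · rintro _ ⟨x, hx, b, hb, rfl⟩
    exact ⟨x + (b - a), Set.add_mem_add hx (sub_mem_cosetSpan hb ha),
      by simp only [vadd_eq_add]; abel⟩

variable [Finite G]

theorem ncard_le_ncard_add (hA : A.Nonempty) (X : Set G) : X.ncard ≤ (X + A).ncard := by
  obtain ⟨a, ha⟩ := hA
  rw [← Set.ncard_vadd_set a]
  refine Set.ncard_le_ncard ?_
  rintro _ ⟨x, hx, rfl⟩
  exact ⟨x, hx, a, ha, add_comm x a⟩

theorem ncard_le_ncard_cosetSpan (A : Set G) : A.ncard ≤ (cosetSpan A : Set G).ncard := by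
  obtain rfl | ⟨a, ha⟩ := A.eq_empty_or_nonempty
  · simp
  · rw [← Set.ncard_vadd_set a (cosetSpan A : Set G)]
    exact Set.ncard_le_ncard (subset_vadd_cosetSpan ha)

theorem ncard_inter_add_add_ncard_sdiff_add (hA : cosetSpan A ≤ K) (X : Set G) (x : G) :
    (X ∩ (x +ᵥ (K : Set G)) + A).ncard + (X \ (x +ᵥ (K : Set G)) + A).ncard = (X + A).ncard := by
  rw [← Set.ncard_union_eq, ← Set.union_add, Set.inter_union_sdiff]
  rw [Set.disjoint_left]
  rintro _ ⟨y, ⟨-, g, hg, rfl⟩, a, ha, rfl⟩ ⟨z, hz, b, hb, heq⟩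
  refine hz.2 ⟨g + (a - b), add_mem hg (cosetSpan_le.1 hA a ha b hb), ?_⟩
  simp only [vadd_eq_add] at heq ⊢
  rw [← add_assoc, ← add_sub_assoc, ← heq, add_sub_cancel_right]

theorem exists_not_le_stabilizer_inter_add (hK : ¬K ≤ stabilizer G (X + A)) :
    ∃ x ∈ X, ¬K ≤ stabilizer G (X ∩ (x +ᵥ (K : Set G)) + A) := by
  contrapose! hK
  intro g hg
  rw [AddAction.mem_stabilizer_set' (Set.toFinite _)]
  rintro _ ⟨x, hx, a, ha, rfl⟩
  have hmem : x + a ∈ X ∩ (x +ᵥ (K : Set G)) + A :=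
    Set.add_mem_add ⟨hx, 0, K.zero_mem, add_zero x⟩ ha
  exact Set.add_subset_add_right Set.inter_subset_left
    ((AddAction.mem_stabilizer_set.1 (hK x hx hg) _).2 hmem)

end CosetDecomposition

section SubgroupExpansion

variable {G : Type*} [AddCommGroup G] {A X : Set G}

/-- `A` expands subgroups: no nonzero subgroup `N`, other than those having a coset that contains
`A`, satisfies `|N + A| < |N| + |A|`. -/
def ExpandsSubgroups (A : Set G) : Prop :=
  ∀ N : AddSubgroup G, N ≠ ⊥ → ¬cosetSpan A ≤ N →
    (N : Set G).ncard + A.ncard ≤ (N + A : Set G).ncard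

theorem ExpandsSubgroups.neg (hA : ExpandsSubgroups A) : ExpandsSubgroups (-A) := by
  intro N hN hspan
  have hneg : (N + -A : Set G) = -(N + A) := by rw [neg_add, neg_coe_set]
  rw [hneg, Set.ncard_neg, Set.ncard_neg]
  exact hA N hN (cosetSpan_neg A ▸ hspan)

variable [Finite G]

theorem exists_addSubgroup_ncard_add_lt_of_subset_vadd {x : G} {K : AddSubgroup G}
    (hX : X.Nonempty) (hA : A.Nonempty) (hXK : X ⊆ x +ᵥ (K : Set G)) (hAK : cosetSpan A ≤ K)
    (hK : ¬K ≤ stabilizer G (X + A)) (hlt : (X + A).ncard + 1 < X.ncard + A.ncard) :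
    ∃ N : AddSubgroup G, N ≠ ⊥ ∧ ¬K ≤ N ∧
      (N + A : Set G).ncard + 1 < (N : Set G).ncard + A.ncard := by
  obtain ⟨a, ha⟩ := hA
  obtain ⟨Y, rfl⟩ := exists_vadd_image_subtype_eq hXK
  obtain ⟨B, rfl⟩ := exists_vadd_image_subtype_eq ((subset_vadd_cosetSpan ha).trans
    (Set.vadd_set_mono hAK))
  have hB : B.Nonempty := by simpa using Set.nonempty_of_mem ha
  rw [vadd_image_subtype_add] at hK hlt
  simp only [ncard_vadd_image_subtype] at hlt
  have huniv : Y + B ≠ Set.univ := by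
    intro huniv
    refine hK fun g hg => ?_
    rw [huniv, Set.image_univ, AddSubgroup.coe_subtype, Subtype.range_coe,
      AddAction.mem_stabilizer_iff, vadd_comm, vadd_coe_set hg]
  obtain ⟨H, hH, hHB, hHlt⟩ :=
    exists_addSubgroup_ncard_add_lt (by simpa using hX) huniv hlt
  have hHX : (H.map K.subtype + (a +ᵥ (K.subtype '' B)) : Set G) =
      a +ᵥ (K.subtype '' (H + B)) := by
    rw [Set.image_add, add_vadd_comm, AddSubgroup.coe_map]
  have hmap : H.map K.subtype ≠ ⊥ :=
    (AddSubgroup.map_eq_bot_iff_of_injective _ K.subtype_injective).not.2 hH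
  refine ⟨H.map K.subtype, hmap, fun hle => hHB ?_, ?_⟩
  · have htop : H = ⊤ := by
      rw [eq_top_iff, ← AddSubgroup.map_subtype_le_map_subtype]
      simpa [← AddMonoidHom.range_eq_map] using hle
    rw [htop, AddSubgroup.coe_top, Set.univ_add hB]
  · rwa [hHX, ncard_vadd_image_subtype, ncard_vadd_image_subtype, AddSubgroup.coe_map,
      Set.ncard_image_of_injective _ K.subtype_injective]

theorem exists_addSubgroup_ncard_add_lt_of_not_le_stabilizer
    (hK : ¬cosetSpan A ≤ stabilizer G (X + A)) (hlt : (X + A).ncard + 1 < X.ncard + A.ncard) :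
    ∃ N : AddSubgroup G, N ≠ ⊥ ∧ ¬cosetSpan A ≤ N ∧
      (N + A : Set G).ncard + 1 < (N : Set G).ncard + A.ncard := by
  have hA : A.Nonempty := by
    by_contra! rfl
    simp at hK
  obtain ⟨x, hx, hxK⟩ := exists_not_le_stabilizer_inter_add hK
  set C : Set G := x +ᵥ (cosetSpan A : Set G)
  have hsplit := ncard_inter_add_add_ncard_sdiff_add le_rfl X x (A := A)
  have hrest : (X \ C).ncard ≤ (X \ C + A).ncard := ncard_le_ncard_add hA _
  have hcard := Set.ncard_inter_add_ncard_sdiff_eq_ncard X C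
  have hmem : x ∈ X ∩ C := ⟨hx, 0, zero_mem _, add_zero x⟩
  exact exists_addSubgroup_ncard_add_lt_of_subset_vadd ⟨x, hmem⟩ hA Set.inter_subset_right
    le_rfl hxK (by lia)

theorem ExpandsSubgroups.ncard_add_le (hA : ExpandsSubgroups A)
    (hX : ¬cosetSpan A ≤ stabilizer G (X + A)) : X.ncard + A.ncard ≤ (X + A).ncard + 1 := by
  by_contra! hlt
  obtain ⟨N, hN, hspan, hNA⟩ := exists_addSubgroup_ncard_add_lt_of_not_le_stabilizer hX hlt
  have := hA N hN hspan
  lia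

theorem ExpandsSubgroups.ncard_add_cosetSpan_lt (hA : ExpandsSubgroups A) (hcard : 2 ≤ A.ncard)
    (hlt : (X + A).ncard < X.ncard + A.ncard) :
    (X + cosetSpan A : Set G).ncard < X.ncard + (cosetSpan A : Set G).ncard := by
  have hnonempty : A.Nonempty := Set.nonempty_of_ncard_ne_zero (by lia)
  by_cases hX : cosetSpan A ≤ stabilizer G (X + A)
  · have := ncard_le_ncard_cosetSpan A
    rw [ncard_add_cosetSpan_eq hnonempty hX]
    lia
  obtain ⟨x, hx, hxK⟩ := exists_not_le_stabilizer_inter_add hX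
  set C : Set G := x +ᵥ (cosetSpan A : Set G)
  have hsplit := ncard_inter_add_add_ncard_sdiff_add le_rfl X x (A := A)
  have hsplitK := Set.ncard_inter_add_ncard_sdiff_eq_ncard X C
  have hinter := hA.ncard_add_le hxK
  have hrest : cosetSpan A ≤ stabilizer G (X \ C + A) := by
    by_contra h
    have := hA.ncard_add_le h
    lia
  have hpos : 0 < (X ∩ C).ncard :=
    (Set.ncard_pos (Set.toFinite _)).2 ⟨x, hx, 0, zero_mem _, add_zero x⟩
  calc (X + cosetSpan A : Set G).ncard
    _ ≤ (X ∩ C + cosetSpan A).ncard + (X \ C + cosetSpan A).ncard := by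
      nth_rw 1 [← Set.inter_union_sdiff X C, Set.union_add]
      exact Set.ncard_union_le _ _
    _ ≤ (cosetSpan A : Set G).ncard + (X \ C).ncard := by
      refine Nat.add_le_add ?_ ?_
      · rw [← Set.ncard_vadd_set x (cosetSpan A : Set G)]
        refine Set.ncard_le_ncard ((Set.add_subset_add_right Set.inter_subset_right).trans ?_)
        rw [vadd_add_assoc, coe_add_coe]
      · rw [ncard_add_cosetSpan_eq hnonempty hrest]
        lia
    _ < _ := by lia

end SubgroupExpansion

section CosetFilling

variable {G : Type*} [AddCommGroup G] {B : Set G} {N : AddSubgroup G} {e f : G}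

theorem disjoint_vadd_of_sub_notMem (hN : f - e ∉ N) :
    Disjoint (f +ᵥ (N : Set G)) (e +ᵥ (N : Set G)) := by
  rw [Set.disjoint_left]
  rintro _ ⟨x, hx, rfl⟩ ⟨y, hy, hxy⟩
  refine hN ?_
  rw [sub_eq_sub_iff_add_eq_add.2 (show f + x = y + e by rw [add_comm y]; exact hxy.symm)]
  exact sub_mem hy hx

variable [Finite G]

theorem ncard_lt_ncard_inter_vadd_union_vadd
    (hB : (N + B : Set G).ncard < (N : Set G).ncard + B.ncard)
    (hf : f ∈ B) (he : e ∈ B) (hN : f - e ∉ N) :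
    (N : Set G).ncard < (B ∩ ((f +ᵥ (N : Set G)) ∪ (e +ᵥ (N : Set G)))).ncard := by
  set U : Set G := (f +ᵥ (N : Set G)) ∪ (e +ᵥ (N : Set G))
  have hU : U.ncard = 2 * (N : Set G).ncard := by
    rw [Set.ncard_union_eq (disjoint_vadd_of_sub_notMem hN), Set.ncard_vadd_set,
      Set.ncard_vadd_set, two_mul]
  have hUB : U ⊆ N + B := by
    rintro _ (⟨g, hg, rfl⟩ | ⟨g, hg, rfl⟩)
    exacts [⟨g, hg, f, hf, add_comm g f⟩, ⟨g, hg, e, he, add_comm g e⟩]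
  have hsdiff : (B \ U).ncard ≤ ((N + B : Set G) \ U).ncard :=
    Set.ncard_le_ncard (Set.sdiff_subset_sdiff_left fun b hb => ⟨0, N.zero_mem, b, hb, zero_add b⟩)
  have := Set.ncard_sdiff_add_ncard_of_subset hUB
  have := Set.ncard_inter_add_ncard_sdiff_eq_ncard B U
  lia

theorem vadd_subset_sub_self (hB : (N + B : Set G).ncard < (N : Set G).ncard + B.ncard)
    (hf : f ∈ B) (he : e ∈ B) (hN : f - e ∉ N) : (f - e) +ᵥ (N : Set G) ⊆ B - B := by
  rintro _ ⟨g, hg, rfl⟩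
  -- Both `B ∩ (f + N)` and the translate of `B ∩ (e + N)` by `f - e + g` lie in `f + N`.
  by_contra hmem
  have hcard := ncard_lt_ncard_inter_vadd_union_vadd hB hf he hN
  rw [Set.inter_union_distrib_left] at hcard
  have hdisjoint : Disjoint (B ∩ (f +ᵥ (N : Set G)))
      ((f - e + g) +ᵥ (B ∩ (e +ᵥ (N : Set G)))) := by
    rw [Set.disjoint_left]
    rintro _ ⟨hx, -⟩ ⟨b, ⟨hb, -⟩, rfl⟩
    exact hmem ⟨_, hx, b, hb, add_sub_cancel_right _ _⟩
  have hsubset : B ∩ (f +ᵥ (N : Set G)) ∪ ((f - e + g) +ᵥ (B ∩ (e +ᵥ (N : Set G)))) ⊆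
      f +ᵥ (N : Set G) := by
    refine Set.union_subset Set.inter_subset_right ?_
    rintro _ ⟨_, ⟨-, x, hx, rfl⟩, rfl⟩
    exact ⟨g + x, add_mem hg hx, by simp only [vadd_eq_add]; abel⟩
  have hle := Set.ncard_le_ncard hsubset
  rw [Set.ncard_union_eq hdisjoint, Set.ncard_vadd_set, Set.ncard_vadd_set] at hle
  have := Set.ncard_union_le (B ∩ (f +ᵥ (N : Set G))) (B ∩ (e +ᵥ (N : Set G)))
  lia

end CosetFilling

section Sidon

variable {G : Type*} [AddCommGroup G] {A M N : Set G}

/-- A Sidon set: one whose nonzero differences have a unique representation. It is encoded by the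
equivalent condition that distinct translates have at most one common element. -/
def IsSidon (M : Set G) : Prop :=
  Pairwise fun x y : G => ((x +ᵥ M) ∩ (y +ᵥ M)).Subsingleton

variable [Finite G]

theorem IsSidon.expandsSubgroups (hM : IsSidon M) : ExpandsSubgroups M := by
  intro N hN hspan
  by_contra! hlt
  rw [cosetSpan_le] at hspan
  push Not at hspan
  obtain ⟨f, hf, e, he, hfe⟩ := hspan
  obtain ⟨g, hg, hg0⟩ := N.bot_or_exists_ne_zero.resolve_left hN
  set U : Set G := (f +ᵥ (N : Set G)) ∪ (e +ᵥ (N : Set G))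
  have hW : (N : Set G).ncard < (M ∩ U).ncard :=
    ncard_lt_ncard_inter_vadd_union_vadd hlt hf he hfe
  have hU : U.ncard ≤ (N : Set G).ncard + (N : Set G).ncard := by
    simpa only [Set.ncard_vadd_set] using
      Set.ncard_union_le (f +ᵥ (N : Set G)) (e +ᵥ (N : Set G))
  have hgU : g +ᵥ U = U := by
    rw [Set.vadd_set_union, vadd_comm g f, vadd_comm g e, vadd_coe_set hg]
  have hunion : ((M ∩ U) ∪ (g +ᵥ (M ∩ U))).ncard ≤ U.ncard :=
    Set.ncard_le_ncard (Set.union_subset Set.inter_subset_right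
      ((Set.vadd_set_mono Set.inter_subset_right).trans hgU.subset))
  have hinter : ((M ∩ U) ∩ (g +ᵥ (M ∩ U))).ncard ≤ 1 := by
    rw [Set.ncard_le_one_iff_subsingleton]
    refine (hM hg0.symm).anti (Set.inter_subset_inter ?_ ?_)
    · rw [zero_vadd]
      exact Set.inter_subset_left
    · exact Set.vadd_set_mono Set.inter_subset_left
  have hcard := Set.ncard_union_add_ncard_inter (M ∩ U) (g +ᵥ (M ∩ U))
  rw [Set.ncard_vadd_set] at hcard
  lia

theorem IsSidon.ncard_vadd_inter_add_le (hM : IsSidon M) {X : Set G} {x : G} (hx : x ∉ X) :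
    ((x +ᵥ M) ∩ (X + M)).ncard ≤ X.ncard := by
  have hex : ∀ z ∈ (x +ᵥ M) ∩ (X + M), ∃ y ∈ X, z ∈ y +ᵥ M := by
    rintro _ ⟨-, y, hy, m, hm, rfl⟩
    exact ⟨y, hy, m, hm, rfl⟩
  choose! c hcX hcM using hex
  refine Set.ncard_le_ncard_of_injOn c hcX fun z hz w hw hzw => ?_
  have hne : x ≠ c z := fun h => hx (h ▸ hcX z hz)
  exact hM hne ⟨hz.1, hcM z hz⟩ ⟨hw.1, hzw ▸ hcM w hw⟩

theorem IsSidon.ncard_mul_le (hM : IsSidon M) (X : Set G) :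
    X.ncard * M.ncard ≤ (X + M).ncard + X.ncard.choose 2 := by
  induction X, Set.toFinite X using Set.Finite.induction_on with
  | empty => simp
  | @insert x X hx _ ih =>
    have hinter := hM.ncard_vadd_inter_add_le hx
    have hunion := Set.ncard_union_add_ncard_inter (x +ᵥ M) (X + M)
    have hinsert : insert x X + M = (x +ᵥ M) ∪ (X + M) := by
      rw [Set.insert_eq, Set.union_add, Set.singleton_add]
      rfl
    rw [Set.ncard_vadd_set] at hunion
    rw [hinsert, Set.ncard_insert_of_notMem hx, Nat.choose_succ_succ, Nat.choose_one_right,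
      add_one_mul]
    lia

theorem IsSidon.ncard_le_two (hM : IsSidon M) (hN : IsSidon N) (hcard : 2 ≤ N.ncard)
    (hlt : (N + M).ncard < N.ncard + M.ncard) : M.ncard ≤ 2 := by
  by_contra! hthree
  obtain ⟨X, hXN, hX⟩ := Set.exists_subset_card_eq hcard
  obtain ⟨Y, hYM, hY⟩ := Set.exists_subset_card_eq hthree
  have hXM : 2 * M.ncard ≤ (N + M).ncard + 1 := by
    have := hM.ncard_mul_le X
    rw [hX] at this
    exact this.trans (by gcongr; exacts [Set.toFinite _, Nat.le_refl 1])
  have hYN : 3 * N.ncard ≤ (N + M).ncard + 3 := by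
    have := hN.ncard_mul_le Y
    rw [hY, add_comm Y] at this
    exact this.trans (by gcongr; exacts [Set.toFinite _, Nat.le_refl 3])
  lia

theorem IsSumsetAtom.isSidon_or_coe_stabilizer_eq (hM : IsSumsetAtom 2 A M) (hzero : 0 ∈ M) :
    IsSidon M ∨ (stabilizer G M : Set G) = M := by
  refine or_iff_not_imp_left.2 fun hSidon => ?_
  simp only [IsSidon, Pairwise, not_forall, Set.not_subsingleton_iff] at hSidon
  obtain ⟨x, y, hxy, hinter⟩ := hSidon
  have hstab : (y - x) +ᵥ M = M := by
    rw [sub_eq_neg_add, add_vadd, neg_vadd_eq_iff]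
    exact ((hM.vadd x).eq_of_le_ncard_inter (hM.vadd y)
      (Set.one_lt_ncard_iff_nontrivial.2 hinter)).symm
  refine hM.coe_stabilizer_eq hzero fun z hz => ?_
  rw [Nat.succ_le_iff, Set.one_lt_ncard_iff_nontrivial]
  have hmem : y - x ∈ M := hstab ▸ ⟨0, hzero, add_zero _⟩
  refine ⟨z, ⟨hz, 0, hzero, add_zero z⟩, z + (y - x), ⟨?_, y - x, hmem, rfl⟩,
    by simpa [sub_eq_zero] using hxy.symm⟩
  rw [← hstab]
  exact ⟨z, hz, add_comm _ z⟩

end Sidon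

section Vosper

variable {G : Type*} [AddCommGroup G] [Finite G] {A M X : Set G}

theorem IsSumsetAtom.isSidon (hM : IsSumsetAtom 2 A M) (hzero : 0 ∈ M) (hA : ExpandsSubgroups A)
    (hspan : cosetSpan A = ⊤) (hnonempty : A.Nonempty)
    (hlt : (M + A).ncard < M.ncard + A.ncard) : IsSidon M := by
  refine (hM.isSidon_or_coe_stabilizer_eq hzero).resolve_right fun hstab => ?_
  obtain ⟨hcard, hsum⟩ := hM.separable
  refine hlt.not_ge (hstab ▸ hA (stabilizer G M) (fun hbot => ?_) fun htop => ?_)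
  · rw [← hstab, hbot, AddSubgroup.coe_bot, Set.ncard_singleton] at hcard
    lia
  · rw [hspan, top_le_iff] at htop
    rw [← hstab, htop, AddSubgroup.coe_top, Set.univ_add hnonempty,
      Set.ncard_univ] at hsum
    lia

theorem cosetSpan_ne_bot (hA : 2 ≤ A.ncard) : cosetSpan A ≠ ⊥ := by
  intro hbot
  have := ncard_le_ncard_cosetSpan A
  rw [hbot, AddSubgroup.coe_bot, Set.ncard_singleton] at this
  lia

theorem ExpandsSubgroups.cosetSpan_eq_top (hA : ExpandsSubgroups A) (hspan : cosetSpan A = ⊤)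
    (hM : ExpandsSubgroups M) (hcard : 2 ≤ M.ncard) (hlt : (M + A).ncard < M.ncard + A.ncard) :
    cosetSpan M = ⊤ := by
  by_contra htop
  have := hA (cosetSpan M) (cosetSpan_ne_bot hcard) (by rwa [hspan, top_le_iff])
  have := hM.ncard_add_cosetSpan_lt hcard (X := A) (by rw [add_comm A]; lia)
  rw [add_comm A] at this
  lia

theorem ExpandsSubgroups.ncard_add_ncard_le (hA : ExpandsSubgroups A) (hspan : cosetSpan A = ⊤)
    (hG : ¬IsAddCyclic G) (hcard : 2 ≤ A.ncard) (hX : IsSumsetSeparable 2 A X) :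
    X.ncard + A.ncard ≤ (X + A).ncard := by
  by_contra! hlt
  obtain ⟨M, hM, hMzero⟩ := hX.exists_isSumsetAtom_zero_mem two_pos
  have hMA : (M + A).ncard < M.ncard + A.ncard := by
    have := hM.ncard_add_le X hX
    lia
  have hAnonempty : A.Nonempty := Set.nonempty_of_ncard_ne_zero (by lia)
  have hMSidon := hM.isSidon hMzero hA hspan hAnonempty hMA
  obtain ⟨hMcard, hMsum⟩ := hM.separable
  have hMspan := hA.cosetSpan_eq_top hspan hMSidon.expandsSubgroups hMcard hMA
  -- The roles of `A` and `M` are now exchanged: `A` is `2`-separable with respect to `M`.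
  have hseparable : IsSumsetSeparable 2 M A := ⟨hcard, by rwa [add_comm A]⟩
  obtain ⟨N, hN, hNzero⟩ := hseparable.exists_isSumsetAtom_zero_mem two_pos
  have hNM : (N + M).ncard < N.ncard + M.ncard := by
    have := hN.ncard_add_le A hseparable
    rw [add_comm A] at this
    lia
  have hNSidon := hN.isSidon hNzero hMSidon.expandsSubgroups hMspan ⟨0, hMzero⟩ hNM
  have hMtwo := hMSidon.ncard_le_two hNSidon hN.separable.1 hNM
  exact hG (isAddCyclic_of_cosetSpan_eq_top hMspan (by lia))

end Vosper

section Growth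

variable {G : Type*} [AddCommGroup G] [Finite G] {A B X : Set G} {k l n : ℕ}

theorem ExpandsSubgroups.ncard_add_mul_le_ncard_add (hA : ExpandsSubgroups A)
    (hX : ¬cosetSpan A ≤ stabilizer G (X + hFoldSumset n A)) :
    X.ncard + n * A.ncard ≤ (X + hFoldSumset n A).ncard + n := by
  induction n with
  | zero => simp [hFoldSumset_zero]
  | succ n ih =>
    rw [hFoldSumset_succ, ← add_assoc X] at hX ⊢
    have := ih fun hle => hX (le_stabilizer_add_of_le_stabilizer hle)
    have := hA.ncard_add_le hX
    lia

theorem ExpandsSubgroups.ncard_add_mul_le (hA : ExpandsSubgroups A) (hspan : cosetSpan A = ⊤)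
    (hG : ¬IsAddCyclic G) (hcard : 2 ≤ A.ncard) (hX : IsSumsetSeparable 2 (hFoldSumset n A) X) :
    X.ncard + n * A.ncard ≤ (X + hFoldSumset n A).ncard := by
  have hAnonempty : A.Nonempty := Set.nonempty_of_ncard_ne_zero (by lia)
  obtain ⟨hXcard, hXsum⟩ := hX
  induction n with
  | zero => simp [hFoldSumset_zero]
  | succ n ih =>
    rw [hFoldSumset_succ, ← add_assoc] at hXsum ⊢
    have hle := ncard_le_ncard_add hAnonempty (X + hFoldSumset n A)
    have hXle := ncard_le_ncard_add (hFoldSumset_nonempty hAnonempty n) X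
    have := ih (by lia)
    have := hA.ncard_add_ncard_le hspan hG hcard (X := X + hFoldSumset n A) ⟨by lia, hXsum⟩
    lia

theorem ExpandsSubgroups.mul_ncard_lt (hA : ExpandsSubgroups A)
    (hstab : ¬cosetSpan A ≤ stabilizer G (hFoldDifference k l A)) :
    (k + l) * A.ncard < (hFoldDifference k l A).ncard + (k + l) := by
  rw [hFoldDifference_eq_add] at hstab ⊢
  have hk := hA.ncard_add_mul_le_ncard_add (X := 0) (n := k) fun hle =>
    hstab (le_stabilizer_add_of_le_stabilizer (by rwa [zero_add] at hle))
  have hl := hA.neg.ncard_add_mul_le_ncard_add (X := hFoldSumset k A) (n := l)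
    (by rwa [cosetSpan_neg])
  rw [zero_add, ← Set.singleton_zero, Set.ncard_singleton] at hk
  rw [Set.ncard_neg] at hl
  lia

theorem ExpandsSubgroups.mul_ncard_le (hA : ExpandsSubgroups A) (hspan : cosetSpan A = ⊤)
    (hG : ¬IsAddCyclic G) (hcard : 2 ≤ A.ncard)
    (hT : (hFoldDifference (k + 1) l A).ncard + 2 ≤ Nat.card G) :
    (k + 1 + l) * A.ncard ≤ (hFoldDifference (k + 1) l A).ncard := by
  have hAnonempty : A.Nonempty := Set.nonempty_of_ncard_ne_zero (by lia)
  rw [hFoldDifference_eq_add, hFoldSumset_succ, add_comm _ A] at hT ⊢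
  have hkl := ncard_le_ncard_add (hFoldSumset_nonempty hAnonempty.neg l) (A + hFoldSumset k A)
  have hk := hA.ncard_add_mul_le hspan hG hcard (X := A) (n := k) ⟨hcard, by lia⟩
  have hl := hA.neg.ncard_add_mul_le (by rwa [cosetSpan_neg]) hG (by rwa [Set.ncard_neg])
    (X := A + hFoldSumset k A) (n := l) ⟨by lia, hT⟩
  rw [Set.ncard_neg] at hl
  lia

theorem two_mul_ncard_le_card {L : AddSubgroup G} (hL : L ≠ ⊤) :
    2 * (L : Set G).ncard ≤ Nat.card G := by
  rw [← L.card_mul_index, mul_comm, ← Nat.card_coe_set_eq, SetLike.coe_sort_coe]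
  gcongr
  exact AddSubgroup.one_lt_index_of_ne_top hL

theorem ExpandsSubgroups.isAddCyclic (hB : ExpandsSubgroups B) (hcard : 2 ≤ B.ncard)
    (hstab : stabilizer G (hFoldDifference (k + 1) (l + 1) B) = ⊥)
    (hlarge : Nat.card G < (k + 1 + (l + 1)) * B.ncard) : IsAddCyclic G := by
  have hspan : cosetSpan B = ⊤ := by
    by_contra htop
    have := two_mul_ncard_le_card htop
    have := hB.mul_ncard_lt (k := k + 1) (l := l + 1)
      (by simpa [hstab] using cosetSpan_ne_bot hcard)
    have := (ncard_le_ncard_cosetSpan _).trans (Set.ncard_le_ncard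
      (cosetSpan_hFoldDifference_le (k + 1) (l + 1) B))
    nlinarith
  by_contra hG
  have htop_ne_bot : (⊤ : AddSubgroup G) ≠ ⊥ := hspan ▸ cosetSpan_ne_bot hcard
  have hT : (hFoldDifference (k + 1) (l + 1) B).ncard < Nat.card G :=
    Set.ncard_lt_card fun huniv => htop_ne_bot (by rw [← hstab, huniv, AddAction.stabilizer_univ])
  rw [hFoldDifference_succ_right, sub_eq_add_neg] at hstab hT
  have := hB.neg.ncard_add_le (X := hFoldDifference (k + 1) l B)
    (by rwa [hstab, cosetSpan_neg, hspan, le_bot_iff])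
  rw [Set.ncard_neg] at this
  have := hB.mul_ncard_le hspan hG hcard (k := k) (l := l) (by lia)
  lia

end Growth

section Aperiodic

variable {G : Type*} [AddCommGroup G] [Finite G] {B : Set G} {N : AddSubgroup G}

theorem le_stabilizer_add_sub_self (hB : (N + B : Set G).ncard < (N : Set G).ncard + B.ncard)
    (hspan : ¬cosetSpan B ≤ N) : N ≤ stabilizer G (B + (B - B)) := by
  rw [cosetSpan_le] at hspan
  push Not at hspan
  obtain ⟨f, hf, e, he, hfe⟩ := hspan
  have hescape : ∀ b, ∃ c ∈ B, c - b ∉ N := by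
    intro b
    by_contra! h
    exact hfe (sub_sub_sub_cancel_right f e b ▸ sub_mem (h f hf) (h e he))
  intro g hg
  rw [AddAction.mem_stabilizer_set' (Set.toFinite _)]
  rintro _ ⟨b₁, hb₁, _, ⟨b₂, hb₂, b₃, hb₃, rfl⟩, rfl⟩
  obtain ⟨c, hc, p, hp, q, hq, hpq, n, hn, heq⟩ : ∃ c ∈ B, ∃ p ∈ B, ∃ q ∈ B, p - q ∉ N ∧
      ∃ n ∈ N, b₁ + (b₂ - b₃) = c + (p - q + n) := by
    by_cases h₁ : b₁ - b₃ ∈ N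
    · by_cases h₂ : b₂ - b₃ ∈ N
      · obtain ⟨c, hc, hcb⟩ := hescape b₁
        exact ⟨c, hc, b₁, hb₁, c, hc, fun h => hcb (neg_sub b₁ c ▸ neg_mem h), b₂ - b₃, h₂,
          by abel⟩
      · exact ⟨b₁, hb₁, b₂, hb₂, b₃, hb₃, h₂, 0, N.zero_mem, by abel⟩
    · exact ⟨b₂, hb₂, b₁, hb₁, b₃, hb₃, h₁, 0, N.zero_mem, by abel⟩
  refine ⟨c, hc, p - q + (n + g), vadd_subset_sub_self hB hp hq hpq ⟨_, add_mem hn hg, rfl⟩, ?_⟩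
  simp only [vadd_eq_add, heq]
  abel

theorem expandsSubgroups_of_stabilizer_eq_bot {k l : ℕ}
    (hstab : stabilizer G (hFoldDifference (k + 2) (l + 1) B) = ⊥) : ExpandsSubgroups B := by
  intro N hN hspan
  by_contra! hlt
  have hsplit : hFoldDifference (k + 2) (l + 1) B = B + (B - B) + hFoldDifference k l B := by
    simp only [hFoldDifference_eq_add, hFoldSumset_succ, sub_eq_add_neg]
    ac_rfl
  rw [hsplit] at hstab
  exact hN (le_bot_iff.1 (hstab ▸ le_stabilizer_add_of_le_stabilizer
    (le_stabilizer_add_sub_self hlt hspan)))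

end Aperiodic

section CyclicQuotients

variable {G Q : Type*} [AddCommGroup G] [AddCommGroup Q] [Finite G]

theorem ncard_preimage_eq_mul_card_ker {φ : G →+ Q} (hφ : Function.Surjective φ) (C : Set Q) :
    (φ ⁻¹' C).ncard = C.ncard * Nat.card φ.ker := by
  have : Finite Q := Finite.of_surjective φ hφ
  have hcard := Finset.card_preimage_eq_sum_card_image_eq (f := φ) (s := C.toFinite.toFinset)
    fun _ _ => Set.toFinite _
  rw [C.toFinite.coe_toFinset] at hcard
  rw [← Nat.card_coe_set_eq, hcard, Set.ncard_eq_toFinset_card C, ← smul_eq_mul]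
  exact Finset.sum_const_nat fun q _ =>
    Nat.card_congr (AddMonoidHom.fiberEquivKerOfSurjective hφ q)

theorem card_eq_card_mul_card_ker {φ : G →+ Q} (hφ : Function.Surjective φ) :
    Nat.card G = Nat.card Q * Nat.card φ.ker := by
  simpa using ncard_preimage_eq_mul_card_ker hφ Set.univ

theorem ncard_le_ncard_image_mul_card_ker {φ : G →+ Q} (hφ : Function.Surjective φ) (B : Set G) :
    B.ncard ≤ (φ '' B).ncard * Nat.card φ.ker := by
  rw [← ncard_preimage_eq_mul_card_ker hφ]
  exact Set.ncard_le_ncard (Set.subset_preimage_image φ B)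

theorem exists_surjective_zmod_card_range (χ : Multiplicative G →* ℂˣ) :
    ∃ φ : G →+ ZMod (Nat.card χ.range), Function.Surjective φ ∧
      ∀ x, φ x = 0 ↔ χ (Multiplicative.ofAdd x) = 1 := by
  have : Finite χ.range := Set.finite_range χ
  let e : ZMod (Nat.card χ.range) ≃+ Additive χ.range :=
    zmodAddCyclicAddEquiv (G := Additive χ.range) inferInstance
  refine ⟨e.symm.toAddMonoidHom.comp χ.rangeRestrict.toAdditiveRight,
    e.symm.surjective.comp χ.rangeRestrict_surjective, fun x => ?_⟩
  refine e.symm.map_eq_zero_iff.trans ?_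
  exact Subtype.ext_iff

theorem exists_surjective_zmod_apply_ne_zero {x : G} (hx : x ≠ 0) :
    ∃ (d : ℕ) (φ : G →+ ZMod d), Function.Surjective φ ∧ φ x ≠ 0 := by
  obtain ⟨χ, hχ⟩ := CommGroup.exists_apply_ne_one_of_hasEnoughRootsOfUnity
    (Multiplicative G) ℂ (a := Multiplicative.ofAdd x) hx
  obtain ⟨φ, hφ, hzero⟩ := exists_surjective_zmod_card_range χ
  exact ⟨_, φ, hφ, (hzero x).not.2 hχ⟩

theorem card_range_eq_orderOf (χ : Multiplicative G →* ℂˣ) : Nat.card χ.range = orderOf χ := by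
  have : Finite χ.range := Set.finite_range χ
  rw [← IsCyclic.exponent_eq_card]
  refine Nat.dvd_antisymm (Monoid.exponent_dvd_of_forall_pow_eq_one ?_)
    (orderOf_dvd_of_pow_eq_one (MonoidHom.ext fun x => ?_))
  · rintro ⟨_, x, rfl⟩
    exact Subtype.ext (DFunLike.congr_fun (pow_orderOf_eq_one χ) x)
  · exact congrArg Subtype.val (Monoid.pow_exponent_eq_one (χ.rangeRestrict x))

variable (G) in
theorem exists_surjective_zmod_exponent :
    ∃ φ : G →+ ZMod (AddMonoid.exponent G), Function.Surjective φ := by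
  have : NeZero (Monoid.exponent (Multiplicative G)) := ⟨Monoid.exponent_ne_zero_of_finite⟩
  obtain ⟨e⟩ := CommGroup.monoidHom_mulEquiv_of_hasEnoughRootsOfUnity (Multiplicative G) ℂ
  obtain ⟨g, hg⟩ := Monoid.exists_orderOf_eq_exponent
    (Monoid.ExponentExists.of_finite (G := Multiplicative G))
  obtain ⟨φ, hφ, -⟩ := exists_surjective_zmod_card_range (e.symm g)
  have hcard : Nat.card (e.symm g).range = AddMonoid.exponent G := by
    rw [card_range_eq_orderOf, MulEquiv.orderOf_eq, hg, Monoid.exponent_multiplicative]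
  exact hcard ▸ ⟨φ, hφ⟩

end CyclicQuotients

section LargeSumFree

variable {G : Type*} [AddCommGroup G] {B : Set G} {k l : ℕ}

theorem IsSumFreeKL.image_mk_stabilizer (hB : IsSumFreeKL k l B) :
    IsSumFreeKL k l (QuotientAddGroup.mk' (stabilizer G (hFoldDifference k l B)) '' B) := by
  refine (isSumFreeKL_image_iff _).2 fun x hx hzero => ?_
  have hstab := AddAction.mem_stabilizer_iff.1 (neg_mem ((QuotientAddGroup.eq_zero_iff x).1 hzero))
  rw [isSumFreeKL_iff_zero_notMem_hFoldDifference, ← hstab] at hB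
  exact hB ⟨x, hx, neg_add_cancel x⟩

variable [Finite G]

theorem exists_zmod_isSumFreeKL_image_of_ncard_le_one (hB : IsSumFreeKL k l B)
    (hcard : B.ncard ≤ 1) :
    ∃ (d : ℕ) (φ : G →+ ZMod d), Function.Surjective φ ∧ IsSumFreeKL k l (φ '' B) := by
  have hsubsingleton : (hFoldDifference k l B).Subsingleton := by
    have hbot : cosetSpan B ≤ ⊥ := cosetSpan_le.2 fun a ha b hb =>
      sub_eq_zero.2 (Set.ncard_le_one_iff_subsingleton.1 hcard ha hb)
    exact fun x hx y hy => sub_eq_zero.1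
      (cosetSpan_le.1 ((cosetSpan_hFoldDifference_le k l B).trans hbot) x hx y hy)
  rw [isSumFreeKL_iff_zero_notMem_hFoldDifference] at hB
  rcases hsubsingleton.eq_empty_or_singleton with hT | ⟨x, hT⟩
  · exact ⟨1, 0, Function.surjective_to_subsingleton _,
      (isSumFreeKL_image_iff 0).2 (by simp only [hT, Set.mem_empty_iff_false, false_imp_iff,
        implies_true])⟩
  · have hx : x ≠ 0 := by
      rintro rfl
      exact hB (hT ▸ rfl)
    obtain ⟨d, φ, hφ, hne⟩ := exists_surjective_zmod_apply_ne_zero hx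
    refine ⟨d, φ, hφ, (isSumFreeKL_image_iff φ).2 ?_⟩
    rw [hT]
    rintro _ rfl
    exact hne

theorem exists_zmod_isSumFreeKL_image_of_stabilizer_eq_bot
    (hB : IsSumFreeKL (k + 2) (l + 1) B)
    (hstab : stabilizer G (hFoldDifference (k + 2) (l + 1) B) = ⊥)
    (hlarge : Nat.card G < (k + 2 + (l + 1)) * B.ncard) :
    ∃ (d : ℕ) (φ : G →+ ZMod d), Function.Surjective φ ∧
      IsSumFreeKL (k + 2) (l + 1) (φ '' B) := by
  rcases le_or_gt B.ncard 1 with hcard | hcard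
  · exact exists_zmod_isSumFreeKL_image_of_ncard_le_one hB hcard
  · have hcyclic : IsAddCyclic G :=
      (expandsSubgroups_of_stabilizer_eq_bot hstab).isAddCyclic hcard hstab hlarge
    let e := (zmodAddCyclicAddEquiv hcyclic).symm
    refine ⟨_, e.toAddMonoidHom, e.surjective, (isSumFreeKL_image_iff _).2 fun x hx => ?_⟩
    refine e.map_ne_zero_iff.2 ?_
    rintro rfl
    exact isSumFreeKL_iff_zero_notMem_hFoldDifference.1 hB hx

theorem exists_zmod_isSumFreeKL_image (hk : 0 < k) (hl : 0 < l) (hkl : k ≠ l)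
    (hB : IsSumFreeKL k l B) (hlarge : Nat.card G < (k + l) * B.ncard) :
    ∃ (d : ℕ) (φ : G →+ ZMod d), Function.Surjective φ ∧ IsSumFreeKL k l (φ '' B) := by
  wlog hlt : l < k generalizing k l
  · simpa only [isSumFreeKL_comm (k := l)] using
      this hl hk hkl.symm (isSumFreeKL_comm.1 hB) (add_comm k l ▸ hlarge) (by lia)
  obtain ⟨l, rfl⟩ := Nat.exists_eq_succ_of_ne_zero hl.ne'
  obtain ⟨k, rfl⟩ := Nat.exists_eq_add_of_le' (show 2 ≤ k by lia)
  set H := stabilizer G (hFoldDifference (k + 2) (l + 1) B)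
  let π := QuotientAddGroup.mk' H
  have hπ : Function.Surjective π := QuotientAddGroup.mk'_surjective H
  have hstab : stabilizer (G ⧸ H) (hFoldDifference (k + 2) (l + 1) (π '' B)) = ⊥ := by
    rw [hFoldDifference_image]
    exact AddAction.stabilizer_image_coe_quotient _
  have hlarge' : Nat.card (G ⧸ H) < (k + 2 + (l + 1)) * (π '' B).ncard := by
    refine Nat.lt_of_mul_lt_mul_right (a := Nat.card π.ker) ?_
    calc Nat.card (G ⧸ H) * Nat.card π.ker = Nat.card G := (card_eq_card_mul_card_ker hπ).symm
      _ < (k + 2 + (l + 1)) * B.ncard := hlarge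
      _ ≤ (k + 2 + (l + 1)) * (π '' B).ncard * Nat.card π.ker := by
        rw [mul_assoc]
        exact Nat.mul_le_mul_left _ (ncard_le_ncard_image_mul_card_ker hπ B)
  obtain ⟨d, φ, hφ, hfree⟩ :=
    exists_zmod_isSumFreeKL_image_of_stabilizer_eq_bot hB.image_mk_stabilizer hstab hlarge'
  rw [← Set.image_comp] at hfree
  exact ⟨d, φ.comp π, hφ.comp hπ, hfree⟩

end LargeSumFree

section Density

variable {G Q : Type*} [AddCommGroup G] [AddCommGroup Q] [Finite G] {k l : ℕ}

theorem IsSumFreeKL.ncard_le_maxSumFreeKL {A : Set G} (hA : IsSumFreeKL k l A) :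
    A.ncard ≤ maxSumFreeKL k l G := by
  cases nonempty_fintype G
  refine le_csSup ⟨Fintype.card G, ?_⟩
    ⟨A.toFinite.toFinset, by rwa [A.toFinite.coe_toFinset], (Set.ncard_eq_toFinset_card A).symm⟩
  rintro _ ⟨C, -, rfl⟩
  exact C.card_le_univ

variable (G l) in
theorem exists_ncard_eq_maxSumFreeKL (hk : 0 < k) :
    ∃ A : Set G, IsSumFreeKL k l A ∧ A.ncard = maxSumFreeKL k l G := by
  cases nonempty_fintype G
  have hempty : IsSumFreeKL k l ((∅ : Finset G) : Set G) := by
    refine Set.eq_empty_of_subset_empty ?_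
    rintro _ ⟨⟨f, hf, -⟩, -⟩
    exact absurd (hf ⟨0, hk⟩) (Finset.notMem_empty _)
  obtain ⟨A, hA, hcard⟩ := Nat.sSup_mem
    (s := {m | ∃ A : Finset G, IsSumFreeKL k l (A : Set G) ∧ A.card = m})
    ⟨0, ∅, hempty, Finset.card_empty⟩
    ⟨Fintype.card G, by rintro _ ⟨A, -, rfl⟩; exact A.card_le_univ⟩
  exact ⟨A, hA, (Set.ncard_coe_finset A).trans hcard⟩

/-- The largest proportion of `G` occupied by a `(k, l)`-sum-free set; unlike the size, it can be
compared between a group and its quotients. -/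
noncomputable def sumFreeDensity (k l : ℕ) (G : Type*) [AddCommGroup G] : ℚ :=
  maxSumFreeKL k l G / Nat.card G

theorem IsSumFreeKL.ncard_div_card_le_sumFreeDensity {A : Set G} (hA : IsSumFreeKL k l A) :
    (A.ncard : ℚ) / Nat.card G ≤ sumFreeDensity k l G :=
  div_le_div_of_nonneg_right (by exact_mod_cast hA.ncard_le_maxSumFreeKL) (by positivity)

theorem ncard_preimage_div_card {φ : G →+ Q} (hφ : Function.Surjective φ) (C : Set Q) :
    ((φ ⁻¹' C).ncard : ℚ) / Nat.card G = C.ncard / Nat.card Q := by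
  rw [ncard_preimage_eq_mul_card_ker hφ, card_eq_card_mul_card_ker hφ, Nat.cast_mul, Nat.cast_mul]
  exact mul_div_mul_right _ _ (Nat.cast_ne_zero.2 Nat.card_pos.ne')

theorem ncard_div_card_le_image {φ : G →+ Q} (hφ : Function.Surjective φ) (B : Set G) :
    (B.ncard : ℚ) / Nat.card G ≤ (φ '' B).ncard / Nat.card Q := by
  rw [← ncard_preimage_div_card hφ]
  refine div_le_div_of_nonneg_right ?_ (by positivity)
  exact_mod_cast Set.ncard_le_ncard (Set.subset_preimage_image φ B)

theorem sumFreeDensity_le_of_surjective (hk : 0 < k) {φ : G →+ Q} (hφ : Function.Surjective φ) :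
    sumFreeDensity k l Q ≤ sumFreeDensity k l G := by
  have : Finite Q := Finite.of_surjective φ hφ
  obtain ⟨C, hC, hcard⟩ := exists_ncard_eq_maxSumFreeKL Q l hk
  rw [sumFreeDensity, ← hcard, ← ncard_preimage_div_card hφ]
  exact (hC.preimage φ).ncard_div_card_le_sumFreeDensity

theorem sumFreeDensity_zmod_le_of_dvd (hk : 0 < k) {d v : ℕ} [NeZero v] (hdv : d ∣ v) :
    sumFreeDensity k l (ZMod d) ≤ sumFreeDensity k l (ZMod v) :=
  sumFreeDensity_le_of_surjective (φ := (ZMod.castHom hdv (ZMod d)).toAddMonoidHom) hk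
    (ZMod.castHom_surjective hdv)

end Density

section Intervals

variable {k l d q : ℕ} {c : ℤ}

/-- The residues modulo `d` of the `q + 1` consecutive integers `c, …, c + q`. -/
def zmodInterval (d : ℕ) (c : ℤ) (q : ℕ) : Set (ZMod d) :=
  (fun i : ℕ => ((c + i : ℤ) : ZMod d)) '' Set.Iic q

theorem ncard_zmodInterval (hq : q < d) (c : ℤ) : (zmodInterval d c q).ncard = q + 1 := by
  have hinj : Set.InjOn (fun i : ℕ => ((c + i : ℤ) : ZMod d)) (Set.Iic q) := by
    intro i hi j hj hij
    simp only [Int.cast_add, Int.cast_natCast, add_right_inj, ZMod.natCast_eq_natCast_iff'] at hij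
    rwa [Nat.mod_eq_of_lt (lt_of_le_of_lt hi hq), Nat.mod_eq_of_lt (lt_of_le_of_lt hj hq)] at hij
  rw [zmodInterval, hinj.ncard_image, Set.ncard_eq_toFinset_card', Set.toFinset_Iic, Nat.card_Iic]

theorem zmodInterval_add_zmodInterval (d : ℕ) (a b : ℤ) (p q : ℕ) :
    zmodInterval d a p + zmodInterval d b q = zmodInterval d (a + b) (p + q) := by
  ext x
  constructor
  · rintro ⟨_, ⟨i, hi, rfl⟩, _, ⟨j, hj, rfl⟩, rfl⟩
    exact ⟨i + j, Set.mem_Iic.2 (add_le_add hi hj), by push_cast; ring⟩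
  · rintro ⟨t, ht, rfl⟩
    rw [Set.mem_Iic] at ht
    obtain ⟨i, hi, j, hj, rfl⟩ : ∃ i ≤ p, ∃ j ≤ q, i + j = t :=
      ⟨min t p, by lia, t - p, by lia, by lia⟩
    exact ⟨_, ⟨i, hi, rfl⟩, _, ⟨j, hj, rfl⟩, by push_cast; ring⟩

theorem hFoldSumset_zmodInterval (h d : ℕ) (c : ℤ) (q : ℕ) :
    hFoldSumset h (zmodInterval d c q) = zmodInterval d (h * c) (h * q) := by
  induction h with
  | zero => ext; simp [hFoldSumset_zero, zmodInterval, eq_comm]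
  | succ h ih =>
    rw [hFoldSumset_succ, ih, zmodInterval_add_zmodInterval]
    push_cast
    simp only [add_one_mul]

theorem isSumFreeKL_zmodInterval {r : ℕ} (hr : (d : ℤ) ∣ (k - l) * c - r) (hlow : l * q < r)
    (hhigh : r + k * q < d) : IsSumFreeKL k l (zmodInterval d c q) := by
  rw [IsSumFreeKL, hFoldSumset_zmodInterval, hFoldSumset_zmodInterval,
    Set.eq_empty_iff_forall_notMem]
  rintro _ ⟨⟨i, hi, rfl⟩, j, hj, hij⟩
  have hdvd : (d : ℤ) ∣ r + i - j := by
    have := dvd_sub ((ZMod.intCast_eq_intCast_iff_dvd_sub _ _ _).1 hij) hr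
    ring_nf at this ⊢
    exact this
  rw [Set.mem_Iic] at hi hj
  exact absurd (Int.le_of_dvd (by lia) hdvd) (by lia)

theorem exists_dvd_sub_mul_sub_deltaKL_mul (k l d t : ℕ) :
    ∃ c : ℤ, (d : ℤ) ∣ (k - l) * c - (deltaKL k l d * t : ℕ) := by
  refine ⟨Int.gcdB d (k - l) * t, -(Int.gcdA d (k - l) * t), ?_⟩
  push_cast [deltaKL, Int.gcd_eq_gcd_ab]
  ring

theorem deltaKL_le_pred_mod (hpos : 0 < d)
    (hd : ∀ j : ℕ, 1 ≤ j → j ≤ deltaKL k l d → ¬ d ≡ j [MOD (k + l)]) :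
    deltaKL k l d ≤ (d - 1) % (k + l) := by
  by_contra! hlt
  refine hd ((d - 1) % (k + l) + 1) (by lia) hlt ?_
  calc d = d - 1 + 1 := by lia
    _ ≡ (d - 1) % (k + l) + 1 [MOD k + l] := ((Nat.mod_modEq _ _).symm).add_right 1

theorem exists_isSumFreeKL_zmodInterval (hpos : 0 < d)
    (hd : deltaKL k l d ≤ (d - 1) % (k + l)) :
    ∃ c : ℤ, IsSumFreeKL k l (zmodInterval d c ((d - 1) / (k + l))) := by
  set q := (d - 1) / (k + l)
  set δ := deltaKL k l d
  have hδ : 0 < δ := Int.gcd_pos_of_ne_zero_left _ (by exact_mod_cast hpos.ne')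
  have hdiv : (k + l) * q + (d - 1) % (k + l) = d - 1 := Nat.div_add_mod _ _
  have hlow : l * q < δ * (l * q / δ + 1) := Nat.lt_mul_div_succ _ hδ
  have hhigh : δ * (l * q / δ + 1) ≤ l * q + δ := by
    rw [mul_add_one]
    exact Nat.add_le_add_right (Nat.mul_div_le _ _) _
  rw [add_mul] at hdiv
  obtain ⟨c, hc⟩ := exists_dvd_sub_mul_sub_deltaKL_mul k l d (l * q / δ + 1)
  exact ⟨c, isSumFreeKL_zmodInterval hc hlow (by lia)⟩

theorem inv_le_sumFreeDensity_zmod (hk : 0 < k) [NeZero d]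
    (hd : ∀ j : ℕ, 1 ≤ j → j ≤ deltaKL k l d → ¬ d ≡ j [MOD (k + l)]) :
    ((k + l : ℕ) : ℚ)⁻¹ ≤ sumFreeDensity k l (ZMod d) := by
  have hpos : 0 < d := NeZero.pos d
  have hkl : 0 < k + l := by lia
  obtain ⟨c, hc⟩ := exists_isSumFreeKL_zmodInterval hpos (deltaKL_le_pred_mod hpos hd)
  have hq : (d - 1) / (k + l) < d := (Nat.div_le_self _ _).trans_lt (by lia)
  have hceil : d ≤ ((d - 1) / (k + l) + 1) * (k + l) := by
    have := Nat.lt_mul_div_succ (d - 1) hkl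
    rw [mul_comm]
    lia
  calc ((k + l : ℕ) : ℚ)⁻¹ = 1 / (k + l : ℕ) := inv_eq_one_div _
    _ ≤ ((d - 1) / (k + l) + 1 : ℕ) / d := by
      rw [div_le_div_iff₀ (by exact_mod_cast hkl) (by exact_mod_cast hpos), one_mul]
      exact_mod_cast hceil
    _ ≤ sumFreeDensity k l (ZMod d) := by
      simpa only [ncard_zmodInterval hq c, Nat.card_zmod] using
        hc.ncard_div_card_le_sumFreeDensity

end Intervals

section Exponent

variable {G : Type*} [AddCommGroup G] [Finite G] {B : Set G} {k l : ℕ}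

theorem ncard_div_card_le_sumFreeDensity_zmod_exponent (hk : 0 < k) (hl : 0 < l) (hkl : k ≠ l)
    (hB : IsSumFreeKL k l B) (hlarge : Nat.card G < (k + l) * B.ncard) :
    (B.ncard : ℚ) / Nat.card G ≤ sumFreeDensity k l (ZMod (AddMonoid.exponent G)) := by
  obtain ⟨c, φ, hφ, hfree⟩ := exists_zmod_isSumFreeKL_image hk hl hkl hB hlarge
  have hv : AddMonoid.exponent G ≠ 0 := AddMonoid.exponent_ne_zero_of_finite
  have hcv : c ∣ AddMonoid.exponent G := ZMod.exponent c ▸ AddMonoidHom.exponent_dvd hφ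
  have : NeZero (AddMonoid.exponent G) := ⟨hv⟩
  have : NeZero c := ⟨ne_zero_of_dvd_ne_zero hv hcv⟩
  calc (B.ncard : ℚ) / Nat.card G ≤ (φ '' B).ncard / Nat.card (ZMod c) :=
        ncard_div_card_le_image hφ B
    _ ≤ sumFreeDensity k l (ZMod c) := hfree.ncard_div_card_le_sumFreeDensity
    _ ≤ sumFreeDensity k l (ZMod (AddMonoid.exponent G)) := sumFreeDensity_zmod_le_of_dvd hk hcv

theorem sumFreeDensity_le_max (hk : 0 < k) (hl : 0 < l) (hkl : k ≠ l) :
    sumFreeDensity k l G ≤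
      max ((k + l : ℕ) : ℚ)⁻¹ (sumFreeDensity k l (ZMod (AddMonoid.exponent G))) := by
  obtain ⟨B, hB, hcard⟩ := exists_ncard_eq_maxSumFreeKL G l hk
  rw [sumFreeDensity, ← hcard, le_max_iff, or_iff_not_imp_left, not_le]
  intro hlt
  refine ncard_div_card_le_sumFreeDensity_zmod_exponent hk hl hkl hB ?_
  rw [inv_eq_one_div, div_lt_div_iff₀ (by positivity) (Nat.cast_pos.2 Nat.card_pos), one_mul] at hlt
  rw [mul_comm]
  exact_mod_cast hlt

end Exponent

theorem theorem5 {G : Type*} [AddCommGroup G] [Finite G] (k l : ℕ)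
    (hk : 0 < k) (hl : 0 < l) (hkl : k ≠ l)
    (hd : ∃ d : ℕ, d ∣ AddMonoid.exponent G ∧
      ∀ j : ℕ, 1 ≤ j → j ≤ deltaKL k l d → ¬ d ≡ j [MOD (k + l)]) :
    (maxSumFreeKL k l G : ℚ) =
      (maxSumFreeKL k l (ZMod (AddMonoid.exponent G)) : ℚ) *
        ((Nat.card G : ℚ) / (AddMonoid.exponent G : ℚ)) := by
  have hv : AddMonoid.exponent G ≠ 0 := AddMonoid.exponent_ne_zero_of_finite
  have : NeZero (AddMonoid.exponent G) := ⟨hv⟩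
  obtain ⟨φ, hφ⟩ := exists_surjective_zmod_exponent G
  obtain ⟨d, hdv, hd⟩ := hd
  have : NeZero d := ⟨ne_zero_of_dvd_ne_zero hv hdv⟩
  have hle : sumFreeDensity k l G ≤ sumFreeDensity k l (ZMod (AddMonoid.exponent G)) :=
    (sumFreeDensity_le_max hk hl hkl).trans (max_le
      ((inv_le_sumFreeDensity_zmod hk hd).trans (sumFreeDensity_zmod_le_of_dvd hk hdv)) le_rfl)
  have heq := hle.antisymm (sumFreeDensity_le_of_surjective hk hφ)
  rw [sumFreeDensity, sumFreeDensity, Nat.card_zmod,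
    div_eq_iff (Nat.cast_ne_zero.2 Nat.card_pos.ne')] at heq
  rw [heq, div_mul_eq_mul_div, mul_div_assoc]
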